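/- A topological drawing of the complete graph $K_n$ maps the vertices to distinct points of the plane $\mathbb{R}^2$ and each edge to a simple curve connecting its two end-vertices and containing no other vertex, such that any two edges have at most one common point, which is either a common vertex or a crossing (not a touching), and no three edges cross in a single point. A triangle is the subdrawing induced by three vertices; its sides are the closures of the two connected components (one bounded, one unbounded) of its complement. A side is convex if every edge with both end-vertices in the side is drawn completely in the side. A drawing is face-convex if it has a face $f_\infty$ (a connected component of the complement of the drawing) such that, for every triangle, the side not containing $f_\infty$ is convex. A triangle contains a point $x$ if $x$ lies in its bounded side. Proposition. The Colorful Carathéodory Theorem fails for face-convex drawings. More precisely, there exist a face-convex topological drawing $D$ of $K_9$, a coloring of its nine vertices with three colors, each used exactly three times, and a point $x$ not on the drawing, such that each of the three monochromatic triangles contains $x$, but no triangle with one vertex of each color contains $x$. Moreover, $D$ can be taken to be obtained from a straight-line drawing of $K_9$ by choosing another outer face, that is, some homeomorphism of the sphere $\mathbb{R}^2\cup\{\infty\}$ maps the vertices and edges of a straight-line drawing of $K_9$ to the corresponding vertices and edges of $D$. -/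

import Mathlib

/-- The Euclidean plane. -/
abbrev Plane : Type := EuclideanSpace ℝ (Fin 2)

/-- `A` is a simple curve (with its endpoints) connecting `p` and `q`. -/
def IsSimpleCurve (p q : Plane) (A : Set Plane) : Prop :=
  ∃ γ : unitInterval → Plane, Continuous γ ∧ Function.Injective γ ∧
    γ 0 = p ∧ γ 1 = q ∧ Set.range γ = A

/-- The curves `A` and `B` cross (rather than touch) at `p`: near `p`, up to a homeomorphism,
they look like the two coordinate axes at the origin. -/
def IsCrossing (A B : Set Plane) (p : Plane) : Prop :=
  ∃ φ : OpenPartialHomeomorph Plane Plane, p ∈ φ.source ∧ φ p = 0 ∧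
    ∀ q ∈ φ.source, (q ∈ A ↔ φ q 1 = 0) ∧ (q ∈ B ↔ φ q 0 = 0)

/-- A (simple) topological drawing, in the plane, of the complete graph with vertex set `V`.
The edge joining `u ≠ v` is drawn as `edge s(u, v)`; values of `edge` on the diagonal of `Sym2 V`
have no meaning and are never used. -/
structure TopologicalDrawing (V : Type) where
  vertex : V → Plane
  edge : Sym2 V → Set Plane
  vertex_injective : Function.Injective vertex
  edge_isSimpleCurve : ∀ u v, u ≠ v → IsSimpleCurve (vertex u) (vertex v) (edge s(u, v))
  /-- Edges contain no vertices besides their endpoints. -/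
  mem_of_vertex_mem_edge : ∀ e : Sym2 V, ¬ e.IsDiag → ∀ w, vertex w ∈ edge e → w ∈ e
  /-- Two edges have at most one common point. -/
  edge_inter_subsingleton : ∀ e f : Sym2 V, ¬ e.IsDiag → ¬ f.IsDiag → e ≠ f →
    (edge e ∩ edge f).Subsingleton
  /-- A common point of two edges is a common vertex or a crossing. -/
  common_vertex_or_crossing : ∀ e f : Sym2 V, ¬ e.IsDiag → ¬ f.IsDiag → e ≠ f →
    ∀ p ∈ edge e ∩ edge f,
      (∃ v, v ∈ e ∧ v ∈ f ∧ vertex v = p) ∨ IsCrossing (edge e) (edge f) p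
  /-- No three edges cross in a single point. -/
  no_triple_crossing : ∀ e f g : Sym2 V, ¬ e.IsDiag → ¬ f.IsDiag → ¬ g.IsDiag →
    e ≠ f → e ≠ g → f ≠ g → ∀ p, p ∈ edge e → p ∈ edge f → p ∈ edge g →
      p ∈ Set.range vertex

namespace TopologicalDrawing

variable {V : Type}

/-- The set of all points of the plane covered by the drawing. -/
def carrier (D : TopologicalDrawing V) : Set Plane :=
  Set.range D.vertex ∪ {p | ∃ e : Sym2 V, ¬ e.IsDiag ∧ p ∈ D.edge e}

/-- The faces (cells) of the drawing: the connected components of its complement. -/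
def IsFace (D : TopologicalDrawing V) (F : Set Plane) : Prop :=
  ∃ p ∈ D.carrierᶜ, F = connectedComponentIn D.carrierᶜ p

/-- The closed curve formed by the three edges between `a`, `b`, `c`
(used for distinct vertices only). -/
def triangle (D : TopologicalDrawing V) (a b c : V) : Set Plane :=
  D.edge s(a, b) ∪ D.edge s(b, c) ∪ D.edge s(a, c)

/-- The sides of the triangle `abc`: the closures of the connected components of its
complement. -/
def IsSide (D : TopologicalDrawing V) (a b c : V) (S : Set Plane) : Prop :=
  ∃ p ∈ (D.triangle a b c)ᶜ, S = closure (connectedComponentIn (D.triangle a b c)ᶜ p)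

/-- A side is convex if every edge with both end-vertices in it is completely drawn in it. -/
def IsConvexSide (D : TopologicalDrawing V) (S : Set Plane) : Prop :=
  ∀ u v, u ≠ v → D.vertex u ∈ S → D.vertex v ∈ S → D.edge s(u, v) ⊆ S

/-- Face-convex drawings: there is a special face such that, for every triangle, the side not
containing this face is convex. -/
def IsFaceConvex (D : TopologicalDrawing V) : Prop :=
  ∃ F, D.IsFace F ∧ ∀ a b c, a ≠ b → b ≠ c → a ≠ c →
    ∀ S, D.IsSide a b c S → ¬ F ⊆ S → D.IsConvexSide S

/-- The triangle `abc` contains `x`: the point `x` lies in its bounded side (which is closed). -/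
def TriangleContains (D : TopologicalDrawing V) (a b c : V) (x : Plane) : Prop :=
  ∃ S, D.IsSide a b c S ∧ Bornology.IsBounded S ∧ x ∈ S

/-- All edges are drawn as straight-line segments. -/
def IsStraightLine (D : TopologicalDrawing V) : Prop :=
  ∀ u v, u ≠ v → D.edge s(u, v) = segment ℝ (D.vertex u) (D.vertex v)

/-- `D` and `D'` are the same drawing on the sphere (the one-point compactification of the plane)
up to a homeomorphism of the sphere; in the plane they may differ in the choice of the outer
face. -/
def SameOnSphere (D D' : TopologicalDrawing V) : Prop :=
  ∃ h : OnePoint Plane ≃ₜ OnePoint Plane,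
    (∀ v, h (D.vertex v : OnePoint Plane) = (D'.vertex v : OnePoint Plane)) ∧
    ∀ u v, u ≠ v →
      h '' ((fun p : Plane => (p : OnePoint Plane)) '' D.edge s(u, v)) =
        (fun p : Plane => (p : OnePoint Plane)) '' D'.edge s(u, v)

end TopologicalDrawing

/-! On the sphere, a triangle contains a point exactly when it separates that point from infinity.
Take a straight-line drawing and two points `o`, `y` off it, and move `o` to infinity. The new
triangles containing the image of `y` are then the old triangles that separate `o` from `y`. So it
suffices to find nine points in general position with three color classes of size three, such that
every monochromatic triangle separates `o` from `y` and no rainbow triangle does. `ninePoints` is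
such a configuration for `o = (0, 0)` and `y = (-2, -1)`; `ninePoints_monochromatic` and
`ninePoints_rainbow` verify it by a finite integer computation.

The move is inversion in the unit circle (`TopologicalDrawing.invert`), which extends to the sphere
and exchanges the origin with infinity. No Jordan curve theorem is needed: the two components of the
complement of an inverted triangle are found explicitly in `component_eq_inv_openTriangle` and
`component_eq_invExterior`. Containment is then read off by `triangleContains_invert` and
`not_triangleContains_invert`.

Face-convexity (`isFaceConvex_invert`) is inherited from straight lines. The old unbounded face
becomes the special face around `0`, the side avoiding it comes from the old closed triangle, and
that triangle is convex. -/

open Set Filter Topology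

/-! ### Signed areas, collinearity and concurrency. -/

/-- Twice the signed area of the triangle `abc`. -/
def orient (a b c : Plane) : ℝ := (b 0 - a 0) * (c 1 - a 1) - (b 1 - a 1) * (c 0 - a 0)

theorem Plane.ext {p q : Plane} (h0 : p 0 = q 0) (h1 : p 1 = q 1) : p = q := by
  ext i
  fin_cases i
  · exact h0
  · exact h1

@[fun_prop]
theorem continuous_orient (a b : Plane) : Continuous (orient a b) := by
  unfold orient
  fun_prop

theorem orient_comb (a b u v : Plane) {s t : ℝ} (h : s + t = 1) :
    orient a b (s • u + t • v) = s * orient a b u + t * orient a b v := by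
  obtain rfl : t = 1 - s := by linarith
  simp [orient]
  ring

theorem orient_self_left (a b : Plane) : orient a b a = 0 := by simp [orient]

theorem orient_self_right (a b : Plane) : orient a b b = 0 := by simp [orient]; ring

theorem orient_rotate (a b c : Plane) : orient b c a = orient a b c := by simp [orient]; ring

theorem orient_swap (a b c : Plane) : orient b a c = -orient a b c := by simp [orient]; ring

theorem orient_add (a b c q : Plane) :
    orient b c q + orient c a q + orient a b q = orient a b c := by simp [orient]; ring

theorem orient_eq_zero_of_mem_segment {a b p : Plane} (h : p ∈ segment ℝ a b) :
    orient a b p = 0 := by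
  obtain ⟨s, t, -, -, hst, rfl⟩ := h
  rw [orient_comb _ _ _ _ hst, orient_self_left, orient_self_right]
  ring

/-- Barycentric coordinates. -/
theorem eq_barycentric {a b c : Plane} (h : orient a b c ≠ 0) (q : Plane) :
    q = (orient b c q / orient a b c) • a + (orient c a q / orient a b c) • b +
      (orient a b q / orient a b c) • c := by
  apply Plane.ext
  · simp only [PiLp.add_apply, PiLp.smul_apply, smul_eq_mul]
    field_simp
    simp only [orient]
    ring
  · simp only [PiLp.add_apply, PiLp.smul_apply, smul_eq_mul]
    field_simp
    simp only [orient]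
    ring

/-- Two distinct points determine a line. -/
theorem orient_eq_zero_of_two_points {a b c p q : Plane} (hpq : p ≠ q)
    (hp : orient a b p = 0) (hq : orient a b q = 0) (hc : orient p q c = 0) :
    orient a b c = 0 := by
  by_contra h
  -- Each coordinate of `q - p`, times the signed area, is a combination of the three vanishing
  -- areas; a nonzero area would force `p = q`.
  have key : ∀ i, (q i - p i) * orient a b c = 0 := by
    intro i
    fin_cases i
    · change (q 0 - p 0) * orient a b c = 0
      simp only [orient] at *
      linear_combination (b 0 - a 0) * hc + (c 0 - p 0) * hq - (c 0 - q 0) * hp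
    · change (q 1 - p 1) * orient a b c = 0
      simp only [orient] at *
      linear_combination (b 1 - a 1) * hc + (c 1 - p 1) * hq - (c 1 - q 1) * hp
  refine hpq (Plane.ext ?_ ?_)
  · have := (mul_eq_zero.1 (key 0)).resolve_right h
    linarith
  · have := (mul_eq_zero.1 (key 1)).resolve_right h
    linarith

/-- If `a, b, p, q` are collinear, so are `p, q, a`. -/
theorem orient_left_eq_zero {a b p q : Plane} (hab : a ≠ b)
    (hp : orient a b p = 0) (hq : orient a b q = 0) : orient p q a = 0 := by
  by_contra h
  have key : ∀ i, (b i - a i) * orient p q a = 0 := by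
    intro i
    fin_cases i
    · change (b 0 - a 0) * orient p q a = 0
      simp only [orient] at *
      linear_combination (p 0 - a 0) * hq - (q 0 - a 0) * hp
    · change (b 1 - a 1) * orient p q a = 0
      simp only [orient] at *
      linear_combination (p 1 - a 1) * hq - (q 1 - a 1) * hp
  refine hab (Plane.ext ?_ ?_)
  · have := (mul_eq_zero.1 (key 0)).resolve_right h
    linarith
  · have := (mul_eq_zero.1 (key 1)).resolve_right h
    linarith

/-- The rows are the coefficients of the three line equations, so `(q 0, q 1, 1)` is a nonzero
kernel vector. The multipliers below are the cofactors of the third column. -/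
theorem det_eq_zero_of_concurrent {a b c d e f q : Plane} (h1 : orient a b q = 0)
    (h2 : orient c d q = 0) (h3 : orient e f q = 0) :
    !![a 1 - b 1, b 0 - a 0, a 0 * b 1 - a 1 * b 0;
       c 1 - d 1, d 0 - c 0, c 0 * d 1 - c 1 * d 0;
       e 1 - f 1, f 0 - e 0, e 0 * f 1 - e 1 * f 0].det = 0 := by
  rw [Matrix.det_fin_three]
  simp only [orient] at *
  simp
  linear_combination ((c 1 - d 1) * (f 0 - e 0) - (d 0 - c 0) * (e 1 - f 1)) * h1
    - ((a 1 - b 1) * (f 0 - e 0) - (b 0 - a 0) * (e 1 - f 1)) * h2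
    + ((a 1 - b 1) * (d 0 - c 0) - (b 0 - a 0) * (c 1 - d 1)) * h3

/-! ### Crossing segments -/

/-- The two inequalities cut out the open strip perpendicular to `ab` between its endpoints. Inside
it the segment agrees with its line, which gives the neighborhood needed for crossings. -/
theorem mem_segment_of_orient_eq_zero {a b q : Plane} (h : orient a b q = 0)
    (h0 : 0 < (b 0 - a 0) * (q 0 - a 0) + (b 1 - a 1) * (q 1 - a 1))
    (h1 : 0 < (b 0 - a 0) * (b 0 - q 0) + (b 1 - a 1) * (b 1 - q 1)) : q ∈ segment ℝ a b := by
  have hN : 0 < (b 0 - a 0) ^ 2 + (b 1 - a 1) ^ 2 := by nlinarith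
  refine ⟨((b 0 - a 0) * (b 0 - q 0) + (b 1 - a 1) * (b 1 - q 1)) /
    ((b 0 - a 0) ^ 2 + (b 1 - a 1) ^ 2), ((b 0 - a 0) * (q 0 - a 0) + (b 1 - a 1) * (q 1 - a 1)) /
    ((b 0 - a 0) ^ 2 + (b 1 - a 1) ^ 2), by positivity, by positivity, ?_, ?_⟩
  · field_simp
    ring
  · simp only [orient] at h
    apply Plane.ext
    · simp only [PiLp.add_apply, PiLp.smul_apply, smul_eq_mul]
      field_simp
      linear_combination (b 1 - a 1) * h
    · simp only [PiLp.add_apply, PiLp.smul_apply, smul_eq_mul]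
      field_simp
      linear_combination -(b 0 - a 0) * h

theorem pos_of_mem_segment {a b p : Plane} (h : p ∈ segment ℝ a b) (ha : p ≠ a) (hb : p ≠ b) :
    0 < (b 0 - a 0) * (p 0 - a 0) + (b 1 - a 1) * (p 1 - a 1) ∧
    0 < (b 0 - a 0) * (b 0 - p 0) + (b 1 - a 1) * (b 1 - p 1) := by
  obtain ⟨s, t, hs, ht, hst, rfl⟩ := h
  obtain rfl : s = 1 - t := by linarith
  have ht' : 0 < t := ht.lt_of_ne fun h => ha (by simp [← h])
  have hs' : 0 < 1 - t := hs.lt_of_ne fun h => hb (by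
    have : t = 1 := by linarith
    simp [this])
  have hab : 0 < (b 0 - a 0) ^ 2 + (b 1 - a 1) ^ 2 := by
    by_contra hneg
    have e0 : b 0 - a 0 = 0 := by nlinarith [sq_nonneg (b 0 - a 0), sq_nonneg (b 1 - a 1)]
    have e1 : b 1 - a 1 = 0 := by nlinarith [sq_nonneg (b 0 - a 0), sq_nonneg (b 1 - a 1)]
    have : a = b := Plane.ext (by linarith) (by linarith)
    subst this
    exact ha (by rw [← add_smul, hst, one_smul])
  constructor
  · have := mul_pos ht' hab
    simp only [PiLp.add_apply, PiLp.smul_apply, smul_eq_mul]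
    nlinarith
  · have := mul_pos hs' hab
    simp only [PiLp.add_apply, PiLp.smul_apply, smul_eq_mul]
    nlinarith

/-- The affine coordinate system whose coordinate axes are two lines crossing at `p`. -/
noncomputable def lineCoords (a b c d p : Plane) (hp : orient a b p = 0) (hp' : orient c d p = 0)
    (k : ℝ) (hk : k = (b 0 - a 0) * (d 1 - c 1) - (b 1 - a 1) * (d 0 - c 0)) (h : k ≠ 0) :
    Plane ≃ₜ Plane where
  toFun q := !₂[orient c d q, orient a b q]
  invFun y := p + (-y 0 / k) • (b - a) + (y 1 / k) • (d - c)
  left_inv q := by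
    simp only [orient] at hp hp'
    apply Plane.ext
    · simp [orient]
      field_simp
      linear_combination (d 0 - c 0) * hp - (b 0 - a 0) * hp' + (p 0 - q 0) * hk
    · simp [orient]
      field_simp
      linear_combination (d 1 - c 1) * hp - (b 1 - a 1) * hp' + (p 1 - q 1) * hk
  right_inv y := by
    simp only [orient] at hp hp'
    apply Plane.ext
    · simp [orient]
      field_simp
      linear_combination k * hp' - y 0 * hk
    · simp [orient]
      field_simp
      linear_combination k * hp - y 1 * hk
  continuous_toFun := by fun_prop
  continuous_invFun := by fun_prop

/-- The chart is `lineCoords`, restricted to the intersection `U` of the two open strips, where both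
segments coincide with their lines. The nonzero determinant says that the lines are not parallel. -/
theorem isCrossing_segment {a b c d p : Plane} (h1 : p ∈ segment ℝ a b) (h2 : p ∈ segment ℝ c d)
    (ha : p ≠ a) (hb : p ≠ b) (hc : p ≠ c) (hd : p ≠ d)
    (h : (b 0 - a 0) * (d 1 - c 1) - (b 1 - a 1) * (d 0 - c 0) ≠ 0) :
    IsCrossing (segment ℝ a b) (segment ℝ c d) p := by
  have e1 := orient_eq_zero_of_mem_segment h1
  have e2 := orient_eq_zero_of_mem_segment h2
  let U : Set Plane := {q | (0 < (b 0 - a 0) * (q 0 - a 0) + (b 1 - a 1) * (q 1 - a 1) ∧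
    0 < (b 0 - a 0) * (b 0 - q 0) + (b 1 - a 1) * (b 1 - q 1)) ∧
    (0 < (d 0 - c 0) * (q 0 - c 0) + (d 1 - c 1) * (q 1 - c 1) ∧
    0 < (d 0 - c 0) * (d 0 - q 0) + (d 1 - c 1) * (d 1 - q 1))}
  have hU : IsOpen U := by
    refine IsOpen.and (IsOpen.and ?_ ?_) (IsOpen.and ?_ ?_) <;>
      exact isOpen_lt (by fun_prop) (by fun_prop)
  refine ⟨(lineCoords a b c d p e1 e2 _ rfl h).toOpenPartialHomeomorph.restrOpen U hU, ?_, ?_, ?_⟩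
  · simp only [OpenPartialHomeomorph.restrOpen_source]
    exact ⟨trivial, pos_of_mem_segment h1 ha hb, pos_of_mem_segment h2 hc hd⟩
  · apply Plane.ext
    · simpa [lineCoords] using e2
    · simpa [lineCoords] using e1
  · intro q hq
    rw [OpenPartialHomeomorph.restrOpen_source] at hq
    have hq' : q ∈ U := hq.2
    have f0 : (((lineCoords a b c d p e1 e2 _ rfl h).toOpenPartialHomeomorph.restrOpen U hU) q) 0 =
      orient c d q := by simp [lineCoords]
    have f1 : (((lineCoords a b c d p e1 e2 _ rfl h).toOpenPartialHomeomorph.restrOpen U hU) q) 1 =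
      orient a b q := by simp [lineCoords]
    rw [f0, f1]
    exact ⟨⟨orient_eq_zero_of_mem_segment, fun e => mem_segment_of_orient_eq_zero e hq'.1.1 hq'.1.2⟩,
      ⟨orient_eq_zero_of_mem_segment, fun e => mem_segment_of_orient_eq_zero e hq'.2.1 hq'.2.2⟩⟩

/-! ### The two sides of a straight-line triangle -/

/-- The open triangle `abc`. -/
def openTriangle (a b c : Plane) : Set Plane :=
  {q | 0 < orient b c q * orient a b c ∧ 0 < orient c a q * orient a b c ∧
    0 < orient a b q * orient a b c}

/-- The closed triangle `abc`. -/
def closedTriangle (a b c : Plane) : Set Plane :=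
  {q | 0 ≤ orient b c q * orient a b c ∧ 0 ≤ orient c a q * orient a b c ∧
    0 ≤ orient a b q * orient a b c}

theorem isOpen_openTriangle (a b c : Plane) : IsOpen (openTriangle a b c) := by
  refine IsOpen.and ?_ (IsOpen.and ?_ ?_) <;> exact isOpen_lt (by fun_prop) (by fun_prop)

theorem isClosed_closedTriangle (a b c : Plane) : IsClosed (closedTriangle a b c) := by
  have key : ∀ u v : Plane, IsClosed {q | 0 ≤ orient u v q * orient a b c} := fun u v =>
    isClosed_le continuous_const ((continuous_orient u v).mul_const _)
  exact (key b c).inter ((key c a).inter (key a b))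

theorem openTriangle_subset_closedTriangle (a b c : Plane) :
    openTriangle a b c ⊆ closedTriangle a b c := fun _ h => ⟨h.1.le, h.2.1.le, h.2.2.le⟩

theorem convex_orient_pos (a b : Plane) (k : ℝ) : Convex ℝ {q | 0 < orient a b q * k} := by
  intro u hu v hv s t hs ht hst
  simp only [mem_ofPred_eq, orient_comb _ _ _ _ hst] at *
  rcases hs.eq_or_lt with rfl | hs
  · obtain rfl : t = 1 := by linarith
    linarith
  · nlinarith [mul_pos hs hu, mul_nonneg ht hv.le]

theorem convex_orient_nonneg (a b : Plane) (k : ℝ) : Convex ℝ {q | 0 ≤ orient a b q * k} := by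
  intro u hu v hv s t hs ht hst
  simp only [mem_ofPred_eq, orient_comb _ _ _ _ hst] at *
  nlinarith [mul_nonneg hs hu, mul_nonneg ht hv]

theorem convex_openTriangle (a b c : Plane) : Convex ℝ (openTriangle a b c) :=
  (convex_orient_pos _ _ _).inter ((convex_orient_pos _ _ _).inter (convex_orient_pos _ _ _))

theorem convex_closedTriangle (a b c : Plane) : Convex ℝ (closedTriangle a b c) :=
  (convex_orient_nonneg _ _ _).inter
    ((convex_orient_nonneg _ _ _).inter (convex_orient_nonneg _ _ _))

theorem mem_segment_of_barycentric {a b c q : Plane} (h : orient a b c ≠ 0)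
    (ha : 0 ≤ orient b c q * orient a b c) (hb : 0 ≤ orient c a q * orient a b c)
    (hc : orient a b q = 0) : q ∈ segment ℝ a b := by
  have hs := orient_add a b c q
  refine ⟨orient b c q / orient a b c, orient c a q / orient a b c, ?_, ?_, ?_, ?_⟩
  -- A quotient `u / o` is `u * o` times the square of `o⁻¹`, so the sign hypothesis on the product
  -- suffices for either orientation of the triangle.
  · rw [div_eq_mul_inv, ← mul_self_mul_inv (orient a b c)⁻¹, inv_inv]
    nlinarith [mul_nonneg ha (mul_self_nonneg (orient a b c)⁻¹)]
  · rw [div_eq_mul_inv, ← mul_self_mul_inv (orient a b c)⁻¹, inv_inv]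
    nlinarith [mul_nonneg hb (mul_self_nonneg (orient a b c)⁻¹)]
  · rw [← add_div, div_eq_one_iff_eq h]
    linarith
  · have := eq_barycentric h q
    rw [hc, zero_div, zero_smul, add_zero] at this
    exact this.symm

theorem segment_subset_closedTriangle_diff (a b c : Plane) :
    segment ℝ a b ⊆ closedTriangle a b c \ openTriangle a b c := by
  intro q hq
  have h0 := orient_eq_zero_of_mem_segment hq
  refine ⟨(convex_closedTriangle a b c).segment_subset ?_ ?_ hq, fun h => ?_⟩
  · refine ⟨?_, ?_, ?_⟩
    · rw [orient_rotate]
      exact mul_self_nonneg _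
    · simp [orient_self_right]
    · simp [orient_self_left]
  · refine ⟨?_, ?_, ?_⟩
    · simp [orient_self_left]
    · rw [orient_rotate, orient_rotate]
      exact mul_self_nonneg _
    · simp [orient_self_right]
  · have := h.2.2
    simp [h0] at this

theorem closedTriangle_rotate (a b c : Plane) : closedTriangle b c a = closedTriangle a b c := by
  ext q
  simp only [closedTriangle, mem_ofPred_eq, orient_rotate a b c]
  tauto

theorem openTriangle_rotate (a b c : Plane) : openTriangle b c a = openTriangle a b c := by
  ext q
  simp only [openTriangle, mem_ofPred_eq, orient_rotate a b c]
  tauto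

/-- The boundary of a triangle is formed by its edges. -/
theorem union_segments_eq {a b c : Plane} (h : orient a b c ≠ 0) :
    segment ℝ a b ∪ segment ℝ b c ∪ segment ℝ a c =
      closedTriangle a b c \ openTriangle a b c := by
  apply Subset.antisymm
  · refine union_subset (union_subset (segment_subset_closedTriangle_diff a b c) ?_) ?_
    · rw [← closedTriangle_rotate, ← openTriangle_rotate]
      exact segment_subset_closedTriangle_diff b c a
    · rw [← closedTriangle_rotate, ← openTriangle_rotate, ← closedTriangle_rotate,
        ← openTriangle_rotate, segment_symm]
      exact segment_subset_closedTriangle_diff c a b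
  · rintro q ⟨⟨h1, h2, h3⟩, hq⟩
    have hz : ∀ {u : ℝ}, 0 ≤ u * orient a b c → ¬ 0 < u * orient a b c → u = 0 := fun p n =>
      (mul_eq_zero.1 (le_antisymm (not_lt.1 n) p)).resolve_right h
    by_cases p3 : 0 < orient a b q * orient a b c
    · by_cases p1 : 0 < orient b c q * orient a b c
      · have p2 := hz h2 fun p2 => hq ⟨p1, p2, p3⟩
        right
        rw [segment_symm]
        have e : orient c a b = orient a b c := by rw [orient_rotate, orient_rotate]
        exact mem_segment_of_barycentric (c := b) (by rwa [e]) (by rwa [e]) (by rwa [e]) p2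
      · left
        right
        have e : orient b c a = orient a b c := orient_rotate a b c
        exact mem_segment_of_barycentric (c := a) (by rwa [e]) (by rwa [e]) (by rwa [e]) (hz h1 p1)
    · left
      left
      exact mem_segment_of_barycentric h h1 h2 (hz h3 p3)

theorem isBounded_closedTriangle {a b c : Plane} (h : orient a b c ≠ 0) :
    Bornology.IsBounded (closedTriangle a b c) := by
  have hfin : ({a, b, c} : Set Plane).Finite := by simp
  refine (isBounded_convexHull.2 hfin.isBounded).subset ?_
  rintro q ⟨h1, h2, h3⟩
  have hs := orient_add a b c q
  have hd : ∀ {u : ℝ}, 0 ≤ u * orient a b c → 0 ≤ u / orient a b c := fun {u} p => by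
    rcases h.lt_or_gt with n | n
    · exact div_nonneg_of_nonpos (by nlinarith) n.le
    · exact div_nonneg (by nlinarith) n.le
  rw [eq_barycentric h q]
  have ha : a ∈ convexHull ℝ ({a, b, c} : Set Plane) := subset_convexHull _ _ (by simp)
  have hb : b ∈ convexHull ℝ ({a, b, c} : Set Plane) := subset_convexHull _ _ (by simp)
  have hc : c ∈ convexHull ℝ ({a, b, c} : Set Plane) := subset_convexHull _ _ (by simp)
  have := (convex_convexHull ℝ ({a, b, c} : Set Plane)).sum_mem (t := Finset.univ)
    (w := ![orient b c q / orient a b c, orient c a q / orient a b c, orient a b q / orient a b c])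
    (z := ![a, b, c]) (by
      intro i _
      fin_cases i
      exacts [hd h1, hd h2, hd h3]) (by
      rw [Fin.sum_univ_three]
      simp only [Matrix.cons_val]
      rw [← add_div, ← add_div, hs, div_self h]) (by
      intro i _
      fin_cases i
      exacts [ha, hb, hc])
  rw [Fin.sum_univ_three] at this
  exact this

/-- Moving any point slightly towards the centroid `g`, whose barycentric coordinates are all `1 /
3`, makes the three inequalities strict. -/
theorem closedTriangle_subset_closure {a b c : Plane} (h : orient a b c ≠ 0) :
    closedTriangle a b c ⊆ closure (openTriangle a b c) := by
  intro q hq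
  let g : Plane := (1 / 3 : ℝ) • (a + b + c)
  have hsq : 0 < orient a b c * orient a b c := mul_self_pos.2 h
  have hg : ∀ u v w : Plane, orient u v ((1 / 3 : ℝ) • (u + v + w)) = orient u v w / 3 := by
    intro u v w
    simp [orient]
    ring
  have h1 : orient b c g = orient a b c / 3 := by
    rw [← orient_rotate a b c, ← hg]
    simp only [g]
    congr 2
    abel
  have h2 : orient c a g = orient a b c / 3 := by
    rw [← orient_rotate a b c, ← orient_rotate b c a, ← hg]
    simp only [g]
    congr 2
    abel
  have h3 : orient a b g = orient a b c / 3 := hg a b c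
  have hlim : Tendsto (fun t : ℝ => (1 - t) • q + t • g) (𝓝[>] 0) (𝓝 q) := by
    have : Continuous fun t : ℝ => (1 - t) • q + t • g := by fun_prop
    have h0 := this.tendsto 0
    simp only [sub_zero, one_smul, zero_smul, add_zero] at h0
    exact h0.mono_left nhdsWithin_le_nhds
  refine mem_closure_of_tendsto hlim ?_
  filter_upwards [Ioo_mem_nhdsGT (zero_lt_one' ℝ)] with t ht
  have ht0 := ht.1
  have ht1 : 0 < 1 - t := by linarith [ht.2]
  have key : ∀ u v : Plane, 0 ≤ orient u v q * orient a b c → orient u v g = orient a b c / 3 →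
      0 < orient u v ((1 - t) • q + t • g) * orient a b c := by
    intro u v p e
    rw [orient_comb _ _ _ _ (by ring), e]
    nlinarith [mul_nonneg ht1.le p, mul_pos ht0 hsq]
  exact ⟨key _ _ hq.1 h1, key _ _ hq.2.1 h2, key _ _ hq.2.2 h3⟩

theorem closure_diff_singleton_of_ne {S : Set Plane} {p q : Plane} (hq : q ∈ closure S)
    (h : q ≠ p) : q ∈ closure (S \ {p}) := by
  have : q ∈ closure S ∩ {p}ᶜ := ⟨hq, h⟩
  have := isOpen_compl_singleton.closure_inter this
  exact this

/-- This half-plane lies across the line `bc` from `a`, so it contains the open ray from `b`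
pointing away from `a`. -/
theorem orient_neg_unbounded {a b c : Plane} (h : orient a b c ≠ 0) :
    ¬ Bornology.IsBounded {q | 0 < orient b c q * (-orient a b c)} := by
  intro hb
  have hsq : 0 < orient a b c * orient a b c := mul_self_pos.2 h
  have hab : b - a ≠ 0 := by
    intro e
    rw [sub_eq_zero] at e
    subst e
    simp [orient] at h
  obtain ⟨R, hR⟩ := hb.exists_norm_le
  have hn : 0 < ‖b - a‖ := norm_pos_iff.2 hab
  -- Chosen so that `t • (b - a)` has length `|R| + ‖b‖ + 1`, which exceeds `R` even after losing
  -- `‖b‖`.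
  let t : ℝ := (|R| + ‖b‖ + 1) / ‖b - a‖
  have ht : 0 < t := by positivity
  have hm : b + t • (b - a) ∈ {q | 0 < orient b c q * (-orient a b c)} := by
    have : orient b c (b + t • (b - a)) = -t * orient a b c := by
      simp [orient]
      ring
    rw [mem_ofPred_eq, this]
    nlinarith [mul_pos ht hsq]
  have h1 := hR _ hm
  have h2 : ‖t • (b - a)‖ = |R| + ‖b‖ + 1 := by
    rw [norm_smul, Real.norm_of_nonneg ht.le]
    exact div_mul_cancel₀ _ hn.ne'
  have h3 : ‖t • (b - a)‖ ≤ ‖b + t • (b - a)‖ + ‖b‖ := by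
    have := norm_sub_le (b + t • (b - a)) b
    simpa using this
  linarith [le_abs_self R]

/-! ### Connectedness of punctured convex open sets. -/

theorem one_lt_rank_plane : 1 < Module.rank ℝ Plane := by
  rw [← Module.finrank_eq_rank]
  simp

/-- The radial map `f` shrinks the connected punctured plane into a small punctured ball inside `C`.
Every `y` in `C` other than `0` is joined to it by the segment from `f y` to `y`, which stays on the
open ray through `y` and so misses `0`. -/
theorem Convex.isPreconnected_diff_zero {C : Set Plane} (hC : Convex ℝ C) (ho : IsOpen C) :
    IsPreconnected (C \ {0}) := by
  by_cases h0 : (0 : Plane) ∈ C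
  swap
  · rw [sdiff_singleton_eq_self h0]
    exact hC.isPreconnected
  obtain ⟨ε, hε, hball⟩ := Metric.isOpen_iff.1 ho 0 h0
  let f : Plane → Plane := fun v => (ε / (1 + ‖v‖)) • v
  have hpos : ∀ v : Plane, 0 < ε / (1 + ‖v‖) := fun v => by positivity
  have hf : Continuous f := by
    refine Continuous.smul (continuous_const.div (continuous_const.add continuous_norm)
      fun v => ?_) continuous_id
    exact ne_of_gt (by positivity : 0 < 1 + ‖v‖)
  have hS : IsPreconnected (f '' {0}ᶜ) :=
    (isConnected_compl_singleton_of_one_lt_rank one_lt_rank_plane 0).isPreconnected.image f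
      hf.continuousOn
  have hSC : f '' {0}ᶜ ⊆ C \ {0} := by
    rintro _ ⟨v, hv, rfl⟩
    refine ⟨hball ?_, smul_ne_zero (hpos v).ne' hv⟩
    rw [mem_ball_zero_iff, norm_smul, Real.norm_of_nonneg (hpos v).le, div_mul_eq_mul_div,
      div_lt_iff₀ (by positivity)]
    nlinarith
  obtain ⟨w, hw⟩ : ∃ w : Plane, w ≠ 0 := ⟨!₂[1, 0], fun h => by
    simpa using congrArg (fun p : Plane => p 0) h⟩
  refine isPreconnected_of_forall (f w) fun y hy => ?_
  refine ⟨f '' {0}ᶜ ∪ segment ℝ (f y) y, union_subset hSC ?_, Or.inl ⟨w, hw, rfl⟩,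
    Or.inr (right_mem_segment _ _ _), hS.union (f y) ⟨y, hy.2, rfl⟩ (left_mem_segment _ _ _)
      (convex_segment _ _).isPreconnected⟩
  have hfy := hSC ⟨y, hy.2, rfl⟩
  intro z hz
  refine ⟨hC.segment_subset hfy.1 hy.1 hz, ?_⟩
  obtain ⟨s, t, hs, ht, hst, rfl⟩ := hz
  have : s • f y + t • y = (s * (ε / (1 + ‖y‖)) + t) • y := by
    simp only [f, smul_smul, add_smul]
  rw [this]
  refine smul_ne_zero (ne_of_gt ?_) hy.2
  rcases hs.eq_or_lt with rfl | hs
  · linarith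
  · have := mul_pos hs (hpos y)
    linarith

/-! ### Inversion in the unit circle -/

/-- Inversion in the unit circle; by convention it fixes the origin. -/
noncomputable def circleInv : Plane → Plane := EuclideanGeometry.inversion 0 1

theorem circleInv_circleInv (p : Plane) : circleInv (circleInv p) = p :=
  EuclideanGeometry.inversion_inversion 0 one_ne_zero p

theorem circleInv_zero : circleInv 0 = 0 := EuclideanGeometry.inversion_self 0 1

theorem circleInv_eq_zero {p : Plane} : circleInv p = 0 ↔ p = 0 :=
  EuclideanGeometry.inversion_eq_center one_ne_zero

theorem norm_circleInv (p : Plane) : ‖circleInv p‖ = ‖p‖⁻¹ := by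
  have := EuclideanGeometry.dist_inversion_center (0 : Plane) p 1
  simpa [circleInv] using this

theorem continuousAt_circleInv {p : Plane} (hp : p ≠ 0) : ContinuousAt circleInv p :=
  ContinuousAt.inversion continuousAt_const continuousAt_const continuousAt_id hp

theorem circleInv_injective : Function.Injective circleInv :=
  Function.Involutive.injective circleInv_circleInv

theorem image_circleInv (S : Set Plane) : circleInv '' S = circleInv ⁻¹' S :=
  congrFun (Function.Involutive.image_eq_preimage_symm circleInv_circleInv) S

theorem tendsto_circleInv_cobounded : Tendsto circleInv (𝓝[≠] 0) (Bornology.cobounded Plane) :=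
  EuclideanGeometry.tendsto_inversion_nhdsNE_center_cobounded one_ne_zero

/-- Inversion as a homeomorphism of the punctured plane. -/
noncomputable def circleInvHomeomorph : OpenPartialHomeomorph Plane Plane where
  toFun := circleInv
  invFun := circleInv
  source := {0}ᶜ
  target := {0}ᶜ
  map_source' _ hp := fun h => hp (circleInv_eq_zero.1 h)
  map_target' _ hp := fun h => hp (circleInv_eq_zero.1 h)
  left_inv' p _ := circleInv_circleInv p
  right_inv' p _ := circleInv_circleInv p
  open_source := isOpen_compl_singleton
  open_target := isOpen_compl_singleton
  continuousOn_toFun _ hp := (continuousAt_circleInv hp).continuousWithinAt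
  continuousOn_invFun _ hp := (continuousAt_circleInv hp).continuousWithinAt

theorem IsCrossing.circleInv {A B : Set Plane} {p : Plane} (h : IsCrossing A B p) (hp : p ≠ 0) :
    IsCrossing (circleInv ⁻¹' A) (circleInv ⁻¹' B) (circleInv p) := by
  obtain ⟨φ, hpφ, h0, hφ⟩ := h
  refine ⟨circleInvHomeomorph.trans φ, ?_, ?_, ?_⟩
  · rw [OpenPartialHomeomorph.trans_source]
    refine ⟨fun h => hp (circleInv_eq_zero.1 h), ?_⟩
    change _root_.circleInv (_root_.circleInv p) ∈ φ.source
    rwa [circleInv_circleInv]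
  · change φ (_root_.circleInv (_root_.circleInv p)) = 0
    rwa [circleInv_circleInv]
  · intro q hq
    rw [OpenPartialHomeomorph.trans_source] at hq
    exact hφ (_root_.circleInv q) hq.2

theorem IsSimpleCurve.circleInv {p q : Plane} {A : Set Plane} (h : IsSimpleCurve p q A)
    (h0 : (0 : Plane) ∉ A) :
    IsSimpleCurve (circleInv p) (circleInv q) (circleInv ⁻¹' A) := by
  obtain ⟨γ, hc, hi, hp, hq, rfl⟩ := h
  refine ⟨_root_.circleInv ∘ γ, ?_, circleInv_injective.comp hi, by simp [hp], by simp [hq], ?_⟩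
  · refine continuous_iff_continuousAt.2 fun t => ?_
    refine ContinuousAt.comp (continuousAt_circleInv fun h => h0 ⟨t, h⟩) hc.continuousAt
  · rw [range_comp, image_circleInv]

/-- Inversion on the sphere exchanges the origin and the point at infinity. -/
noncomputable def sphereInv : OnePoint Plane → OnePoint Plane
  | none => ((0 : Plane) : OnePoint Plane)
  | some p => open Classical in if p = 0 then OnePoint.infty else (circleInv p : OnePoint Plane)

theorem sphereInv_infty : sphereInv OnePoint.infty = ((0 : Plane) : OnePoint Plane) := rfl

theorem sphereInv_zero : sphereInv ((0 : Plane) : OnePoint Plane) = OnePoint.infty := if_pos rfl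

theorem sphereInv_coe {p : Plane} (hp : p ≠ 0) :
    sphereInv (p : OnePoint Plane) = (circleInv p : OnePoint Plane) := if_neg hp

theorem sphereInv_sphereInv (x : OnePoint Plane) : sphereInv (sphereInv x) = x := by
  induction x using OnePoint.rec with
  | infty => rw [sphereInv_infty, sphereInv_zero]
  | coe p =>
    by_cases hp : p = 0
    · rw [hp, sphereInv_zero, sphereInv_infty]
    · rw [sphereInv_coe hp, sphereInv_coe (fun h => hp (circleInv_eq_zero.1 h)),
        circleInv_circleInv]

/-- Away from the two exchanged points this is continuity of `circleInv`. At infinity it follows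
from `‖circleInv p‖ = ‖p‖⁻¹`, and at the origin from the blow-up of `circleInv` there. -/
theorem continuous_sphereInv : Continuous sphereInv := by
  refine continuous_iff_continuousAt.2 fun x => ?_
  induction x using OnePoint.rec with
  | infty =>
    rw [OnePoint.continuousAt_infty', sphereInv_infty]
    have h : Tendsto circleInv (coclosedCompact Plane) (𝓝 0) := by
      rw [coclosedCompact_eq_cocompact, ← Metric.cobounded_eq_cocompact,
        tendsto_zero_iff_norm_tendsto_zero]
      simp only [norm_circleInv]
      exact tendsto_inv_atTop_zero.comp tendsto_norm_cobounded_atTop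
    refine Tendsto.congr' ?_ ((OnePoint.continuous_coe.tendsto (0 : Plane)).comp h)
    have : {(0 : Plane)}ᶜ ∈ coclosedCompact Plane := by
      rw [coclosedCompact_eq_cocompact]
      exact isCompact_singleton.compl_mem_cocompact
    filter_upwards [this] with p hp
    exact (sphereInv_coe hp).symm
  | coe p =>
    rw [OnePoint.continuousAt_coe]
    by_cases hp : p = 0
    · subst hp
      rw [continuousAt_iff_punctured_nhds]
      simp only [Function.comp_apply, sphereInv_zero]
      have h := tendsto_circleInv_cobounded
      rw [Metric.cobounded_eq_cocompact, ← coclosedCompact_eq_cocompact] at h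
      refine Tendsto.congr' ?_ (OnePoint.tendsto_coe_infty.comp h)
      filter_upwards [self_mem_nhdsWithin] with p hp
      exact (sphereInv_coe hp).symm
    · refine ((OnePoint.continuous_coe.continuousAt).comp (continuousAt_circleInv hp)).congr ?_
      filter_upwards [isOpen_compl_singleton.mem_nhds hp] with q hq
      exact (sphereInv_coe hq).symm

noncomputable def sphereInvHomeomorph : OnePoint Plane ≃ₜ OnePoint Plane where
  toFun := sphereInv
  invFun := sphereInv
  left_inv := sphereInv_sphereInv
  right_inv := sphereInv_sphereInv
  continuous_toFun := continuous_sphereInv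
  continuous_invFun := continuous_sphereInv

/-! ### Inverting a region -/

/-- The image under inversion of a region minus the origin. -/
def invRegion (S : Set Plane) : Set Plane := {q | q ≠ 0 ∧ circleInv q ∈ S}

theorem image_diff_zero (S : Set Plane) : circleInv '' (S \ {0}) = invRegion S := by
  rw [image_circleInv]
  ext q
  simp [invRegion, circleInv_eq_zero, and_comm]

theorem isOpen_invRegion {S : Set Plane} (h : IsOpen S) : IsOpen (invRegion S) := by
  refine isOpen_iff_mem_nhds.2 fun q hq => ?_
  filter_upwards [isOpen_compl_singleton.mem_nhds hq.1,
    (continuousAt_circleInv hq.1).preimage_mem_nhds (h.mem_nhds hq.2)] with r h1 h2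
  exact ⟨h1, h2⟩

/-- Inversion is a local homeomorphism off the origin. What happens at `0` depends on boundedness
instead, since `0` plays the role of infinity; the next four lemmas are that dictionary. -/
theorem closure_invRegion {S : Set Plane} {q : Plane} (hq : q ≠ 0) :
    q ∈ closure (invRegion S) ↔ circleInv q ∈ closure S := by
  constructor
  · intro h
    have := mem_closure_image (continuousAt_circleInv hq) h
    refine closure_mono ?_ this
    rintro _ ⟨r, hr, rfl⟩
    exact hr.2
  · intro h
    have h0 : circleInv q ≠ 0 := fun e => hq (circleInv_eq_zero.1 e)
    have := mem_closure_image (continuousAt_circleInv h0)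
      (closure_diff_singleton_of_ne h h0)
    rwa [image_diff_zero, circleInv_circleInv] at this

theorem zero_notMem_closure_invRegion {S : Set Plane} (h : Bornology.IsBounded S) :
    (0 : Plane) ∉ closure (invRegion S) := by
  intro h0
  rw [mem_closure_iff_frequently] at h0
  have h1 := tendsto_circleInv_cobounded (Bornology.isBounded_def.1 h)
  rw [mem_map, mem_nhdsWithin_iff_eventually] at h1
  obtain ⟨q, hq, hq'⟩ := (h0.and_eventually h1).exists
  exact hq' hq.1 hq.2

theorem zero_mem_closure_invRegion {S : Set Plane} (h : ¬ Bornology.IsBounded S) :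
    (0 : Plane) ∈ closure (invRegion S) := by
  rw [Metric.mem_closure_iff]
  intro ε hε
  have : ∃ p ∈ S, ε⁻¹ < ‖p‖ := by
    by_contra! hc
    exact h ((Metric.isBounded_closedBall (x := (0 : Plane)) (r := ε⁻¹)).subset fun p hp => by
      simpa using hc p hp)
  obtain ⟨p, hp, hlt⟩ := this
  have hpos : 0 < ‖p‖ := (inv_pos.2 hε).trans hlt
  refine ⟨circleInv p, ⟨fun e => ?_, by rwa [circleInv_circleInv]⟩, ?_⟩
  · rw [circleInv_eq_zero] at e
    simp [e] at hpos
  · rw [dist_zero_left, norm_circleInv]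
    exact inv_lt_of_inv_lt₀ hε hlt

theorem isBounded_invRegion {S : Set Plane} (h : Sᶜ ∈ 𝓝 (0 : Plane)) :
    Bornology.IsBounded (invRegion S) := by
  obtain ⟨ε, hε, hb⟩ := Metric.mem_nhds_iff.1 h
  refine (Metric.isBounded_closedBall (x := (0 : Plane)) (r := ε⁻¹)).subset fun q hq => ?_
  rw [mem_closedBall_zero_iff]
  have : ε ≤ ‖q‖⁻¹ := by
    rw [← norm_circleInv]
    by_contra! hlt
    exact hb (mem_ball_zero_iff.2 hlt) hq.2
  exact le_inv_of_le_inv₀ hε this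

theorem not_isBounded_invRegion {S : Set Plane} (h : S ∈ 𝓝 (0 : Plane)) :
    ¬ Bornology.IsBounded (invRegion S) := by
  intro hb
  have h1 := tendsto_circleInv_cobounded (Bornology.isBounded_def.1 hb)
  have h2 : ∀ᶠ q in 𝓝[≠] (0 : Plane), False := by
    filter_upwards [h1, self_mem_nhdsWithin, mem_nhdsWithin_of_mem_nhds h] with q a b c
    exact a ⟨fun e => b (circleInv_eq_zero.1 e), by rwa [circleInv_circleInv]⟩
  exact h2.exists.elim fun _ => id

theorem isPreconnected_invRegion {S : Set Plane} (hS : Convex ℝ S) (ho : IsOpen S) :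
    IsPreconnected (invRegion S) := by
  rw [← image_diff_zero]
  exact (hS.isPreconnected_diff_zero ho).image _ fun q hq =>
    (continuousAt_circleInv hq.2).continuousWithinAt

/-! ### The two sides of an inverted triangle -/

/-- The points at infinity and outside the triangle `abc`, after inversion. -/
def invExterior (a b c : Plane) : Set Plane := {0} ∪ invRegion (closedTriangle a b c)ᶜ

/-- The outside of a triangle is the union of three open half-planes. Each is unbounded, so its
inverted image has `0` in its closure and stays connected when `0` is added; the three pieces then
share `0`. -/
theorem isPreconnected_invExterior {a b c : Plane} (h : orient a b c ≠ 0) :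
    IsPreconnected (invExterior a b c) := by
  have key : ∀ a b c : Plane, orient a b c ≠ 0 →
      IsPreconnected ({0} ∪ invRegion {q | 0 < orient b c q * (-orient a b c)}) := by
    intro a b c h
    refine (isPreconnected_invRegion (convex_orient_pos _ _ _)
      (isOpen_lt continuous_const ((continuous_orient b c).mul_const _))).subset_closure
      subset_union_right (union_subset ?_ subset_closure)
    rw [singleton_subset_iff]
    exact zero_mem_closure_invRegion (orient_neg_unbounded h)
  have e1 := orient_rotate a b c
  have e2 := (orient_rotate b c a).trans e1
  have k1 := key a b c h
  have k2 := key b c a (by rwa [e1])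
  have k3 := key c a b (by rwa [e2])
  rw [e1] at k2
  rw [e2] at k3
  have z : ∀ S : Set Plane, (0 : Plane) ∈ {0} ∪ S := fun _ => Or.inl rfl
  have := IsPreconnected.union 0 (mem_union_left _ (z _)) (z _)
    (IsPreconnected.union 0 (z _) (z _) k1 k2) k3
  convert this using 1
  ext q
  simp only [invExterior, invRegion, closedTriangle, mem_union, mem_singleton_iff, mem_ofPred_eq,
    mem_compl_iff, not_and_or, not_le, mul_neg, Left.neg_pos_iff]
  tauto

theorem isPreconnected_inv_openTriangle (a b c : Plane) :
    IsPreconnected (invRegion (openTriangle a b c)) :=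
  isPreconnected_invRegion (convex_openTriangle a b c) (isOpen_openTriangle a b c)

/-- The point `0` is treated apart: `circleInv 0 = 0` is a mere convention, and as the image of
infinity `0` belongs to the exterior even when the original triangle surrounds it. -/
theorem compl_inv_triangle {a b c : Plane}
    (h0 : (0 : Plane) ∉ closedTriangle a b c \ openTriangle a b c) :
    (circleInv ⁻¹' (closedTriangle a b c \ openTriangle a b c))ᶜ =
      invRegion (openTriangle a b c) ∪ invExterior a b c := by
  ext q
  by_cases hq : q = 0
  · subst hq
    simpa [invExterior, circleInv_zero] using h0
  · have := @openTriangle_subset_closedTriangle a b c (circleInv q)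
    simp only [mem_compl_iff, mem_preimage, Set.mem_sdiff, invRegion, invExterior, mem_union,
      mem_ofPred_eq, mem_singleton_iff, hq]
    tauto

theorem disjoint_inv_sides (a b c : Plane) :
    Disjoint (invRegion (openTriangle a b c)) (invExterior a b c) := by
  rw [Set.disjoint_left]
  rintro q ⟨h, h1⟩ (h2 | h2)
  · exact h h2
  · exact h2.2 (openTriangle_subset_closedTriangle a b c h1)

/-- The inverted open triangle is open, and also relatively closed off the curve: a limit point is
not `0` because the triangle is bounded, so it inverts into the closed triangle, and off the curve
this means the open one. -/
theorem IsPreconnected.subset_inv_openTriangle {a b c : Plane} (h : orient a b c ≠ 0)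
    {s : Set Plane} (hs : IsPreconnected s)
    (hsub : s ⊆ (circleInv ⁻¹' (closedTriangle a b c \ openTriangle a b c))ᶜ)
    {p : Plane} (hp : p ∈ s) (hp' : p ∈ invRegion (openTriangle a b c)) :
    s ⊆ invRegion (openTriangle a b c) := by
  refine hs.subset_of_closure_inter_subset (isOpen_invRegion (isOpen_openTriangle a b c))
    ⟨p, hp, hp'⟩ ?_
  rintro q ⟨hq, hqs⟩
  have hqne : q ≠ 0 := by
    rintro rfl
    exact zero_notMem_closure_invRegion
      ((isBounded_closedTriangle h).subset (openTriangle_subset_closedTriangle a b c)) hq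
  rw [closure_invRegion hqne] at hq
  have hcl := closure_minimal (openTriangle_subset_closedTriangle a b c)
    (isClosed_closedTriangle a b c) hq
  by_contra hn
  exact hsub hqs ⟨hcl, fun ho => hn ⟨hqne, ho⟩⟩

theorem component_eq_inv_openTriangle {a b c : Plane} (h : orient a b c ≠ 0)
    (h0 : (0 : Plane) ∉ closedTriangle a b c \ openTriangle a b c) {p : Plane}
    (hp : p ∈ invRegion (openTriangle a b c)) :
    connectedComponentIn (circleInv ⁻¹' (closedTriangle a b c \ openTriangle a b c))ᶜ p =
      invRegion (openTriangle a b c) := by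
  have hsub : invRegion (openTriangle a b c) ⊆
      (circleInv ⁻¹' (closedTriangle a b c \ openTriangle a b c))ᶜ := by
    rw [compl_inv_triangle h0]
    exact subset_union_left
  refine Subset.antisymm ?_
    ((isPreconnected_inv_openTriangle a b c).subset_connectedComponentIn hp hsub)
  exact isPreconnected_connectedComponentIn.subset_inv_openTriangle h
    (connectedComponentIn_subset _ _) (mem_connectedComponentIn (hsub hp)) hp

theorem component_eq_invExterior {a b c : Plane} (h : orient a b c ≠ 0)
    (h0 : (0 : Plane) ∉ closedTriangle a b c \ openTriangle a b c) {p : Plane}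
    (hp : p ∈ invExterior a b c) :
    connectedComponentIn (circleInv ⁻¹' (closedTriangle a b c \ openTriangle a b c))ᶜ p =
      invExterior a b c := by
  have hsub : invExterior a b c ⊆
      (circleInv ⁻¹' (closedTriangle a b c \ openTriangle a b c))ᶜ := by
    rw [compl_inv_triangle h0]
    exact subset_union_right
  refine Subset.antisymm ?_ ((isPreconnected_invExterior h).subset_connectedComponentIn hp hsub)
  intro q hq
  have hq' := connectedComponentIn_subset _ _ hq
  rw [compl_inv_triangle h0] at hq'
  refine hq'.resolve_left fun hqi => ?_
  have := isPreconnected_connectedComponentIn.subset_inv_openTriangle h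
    (connectedComponentIn_subset _ _) hq hqi (mem_connectedComponentIn (hsub hp))
  exact Set.disjoint_left.1 (disjoint_inv_sides a b c) this hp

/-! ### Straight-line drawings -/

/-- Points in general position: no three are collinear, and no three lines spanned by disjoint
pairs are concurrent. -/
structure GeneralPosition {V : Type} (p : V → Plane) : Prop where
  orient_ne_zero : ∀ a b c, a ≠ b → b ≠ c → a ≠ c → orient (p a) (p b) (p c) ≠ 0
  not_concurrent : ∀ e f g : Sym2 V, ¬ e.IsDiag → ¬ f.IsDiag → ¬ g.IsDiag →
    (∀ v ∈ e, v ∉ f) → (∀ v ∈ e, v ∉ g) → (∀ v ∈ f, v ∉ g) → ∀ q,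
      ¬ ((∀ a b, e = s(a, b) → orient (p a) (p b) q = 0) ∧
        (∀ a b, f = s(a, b) → orient (p a) (p b) q = 0) ∧
        ∀ a b, g = s(a, b) → orient (p a) (p b) q = 0)

/-- The segment spanned by an unordered pair of vertices. -/
def segmentEdge {V : Type} (p : V → Plane) : Sym2 V → Set Plane :=
  Sym2.lift ⟨fun u v => segment ℝ (p u) (p v), fun _ _ => segment_symm ℝ _ _⟩

theorem orient_eq_zero_of_mem_segmentEdge {V : Type} {p : V → Plane} {e : Sym2 V} {q : Plane}
    (h : q ∈ segmentEdge p e) (a b : V) (he : e = s(a, b)) : orient (p a) (p b) q = 0 := by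
  subst he
  exact orient_eq_zero_of_mem_segment h

namespace GeneralPosition

variable {V : Type} {p : V → Plane}

theorem mem_of_orient_eq_zero (hp : GeneralPosition p) {a b w : V} (hab : a ≠ b)
    (h : orient (p a) (p b) (p w) = 0) : w ∈ s(a, b) := by
  by_contra hw
  rw [Sym2.mem_iff, not_or] at hw
  exact hp.orient_ne_zero a b w hab (Ne.symm hw.2) (Ne.symm hw.1) h

theorem inter_subsingleton (hp : GeneralPosition p) {e f : Sym2 V} (he : ¬ e.IsDiag)
    (hf : ¬ f.IsDiag) (hef : e ≠ f) : (segmentEdge p e ∩ segmentEdge p f).Subsingleton := by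
  induction e with | _ a b
  induction f with | _ c d
  rw [Sym2.mk_isDiag_iff] at he hf
  rintro q ⟨hq, hq'⟩ r ⟨hr, hr'⟩
  by_contra hqr
  have e1 := orient_eq_zero_of_mem_segment hq
  have e2 := orient_eq_zero_of_mem_segment hr
  have e3 := orient_eq_zero_of_mem_segment hq'
  have e4 := orient_eq_zero_of_mem_segment hr'
  -- General position only speaks of triples, so a vertex other than `c` and `d` is needed; it
  -- exists because `e ≠ f`.
  have hcd : p c ≠ p d := fun h => by
    have : ∃ w : V, w ≠ c ∧ w ≠ d := by
      by_contra! hall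
      have ha : a = c ∨ a = d := or_iff_not_imp_left.2 (hall a)
      have hb : b = c ∨ b = d := or_iff_not_imp_left.2 (hall b)
      rcases ha with rfl | rfl <;> rcases hb with rfl | rfl
      · exact he rfl
      · exact hef rfl
      · exact hef Sym2.eq_swap
      · exact he rfl
    obtain ⟨w, hwc, hwd⟩ := this
    refine hp.orient_ne_zero c d w hf (Ne.symm hwd) (Ne.symm hwc) ?_
    simp [orient, h]
  have hc : orient (p a) (p b) (p c) = 0 :=
    orient_eq_zero_of_two_points hqr e1 e2 (orient_left_eq_zero hcd e3 e4)
  have hd : orient (p a) (p b) (p d) = 0 := by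
    refine orient_eq_zero_of_two_points hqr e1 e2 (orient_left_eq_zero hcd.symm (b := p c) ?_ ?_)
    · rw [orient_swap, e3, neg_zero]
    · rw [orient_swap, e4, neg_zero]
  have hc' := hp.mem_of_orient_eq_zero he hc
  have hd' := hp.mem_of_orient_eq_zero he hd
  exact hef ((Sym2.mem_and_mem_iff hf).1 ⟨hc', hd'⟩)

theorem mem_of_mem_segmentEdge (hp : GeneralPosition p) {e : Sym2 V} (he : ¬ e.IsDiag) {w : V}
    (hw : p w ∈ segmentEdge p e) : w ∈ e := by
  induction e with | _ a b
  rw [Sym2.mk_isDiag_iff] at he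
  exact hp.mem_of_orient_eq_zero he (orient_eq_zero_of_mem_segment hw)

theorem mem_segmentEdge {e : Sym2 V} {v : V} (hv : v ∈ e) : p v ∈ segmentEdge p e := by
  obtain ⟨w, rfl⟩ := hv
  exact left_mem_segment ℝ _ _

theorem eq_vertex_of_mem (hp : GeneralPosition p) {e f : Sym2 V} (he : ¬ e.IsDiag)
    (hf : ¬ f.IsDiag) (hef : e ≠ f) {q : Plane} (hq : q ∈ segmentEdge p e ∩ segmentEdge p f)
    {v : V} (hve : v ∈ e) (hvf : v ∈ f) : p v = q :=
  hp.inter_subsingleton he hf hef ⟨mem_segmentEdge hve, mem_segmentEdge hvf⟩ hq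

theorem isCrossing (hp : GeneralPosition p) {e f : Sym2 V} (he : ¬ e.IsDiag)
    (hf : ¬ f.IsDiag) (hdis : ∀ v, v ∈ e → v ∉ f) {q : Plane}
    (hq : q ∈ segmentEdge p e ∩ segmentEdge p f) :
    IsCrossing (segmentEdge p e) (segmentEdge p f) q := by
  have hne : ∀ v, v ∈ e → q ≠ p v := fun v hv h =>
    hdis v hv (hp.mem_of_mem_segmentEdge hf (h ▸ hq.2))
  have hnf : ∀ v, v ∈ f → q ≠ p v := fun v hv h =>
    hdis v (hp.mem_of_mem_segmentEdge he (h ▸ hq.1)) hv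
  induction e with | _ a b
  induction f with | _ c d
  rw [Sym2.mk_isDiag_iff] at he hf
  refine isCrossing_segment hq.1 hq.2 (hne a (Sym2.mem_mk_left a b)) (hne b (Sym2.mem_mk_right a b))
    (hnf c (Sym2.mem_mk_left c d)) (hnf d (Sym2.mem_mk_right c d)) fun hk => ?_
  have e1 := orient_eq_zero_of_mem_segment hq.1
  have e2 := orient_eq_zero_of_mem_segment hq.2
  have hac : a ≠ c := fun h => hdis a (Sym2.mem_mk_left a b) (h ▸ Sym2.mem_mk_left c d)
  have hbc : b ≠ c := fun h => hdis b (Sym2.mem_mk_right a b) (h ▸ Sym2.mem_mk_left c d)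
  have had : a ≠ d := fun h => hdis a (Sym2.mem_mk_left a b) (h ▸ Sym2.mem_mk_right c d)
  have hcd : p c ≠ p d := fun h => by
    refine hp.orient_ne_zero c d a hf had.symm hac.symm ?_
    simp [orient, h]
  refine hp.orient_ne_zero a b c he hbc hac ?_
  by_contra hn
  -- Parallel edges with the common point `q` would lie on one line, putting `c` on the line `ab`.
  have key : ∀ i, (p d i - p c i) * orient (p a) (p b) (p c) = 0 := by
    intro i
    fin_cases i
    · change (p d 0 - p c 0) * orient (p a) (p b) (p c) = 0
      simp only [orient] at *
      linear_combination (p d 0 - p c 0) * e1 - (p b 0 - p a 0) * e2 - (q 0 - p c 0) * hk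
    · change (p d 1 - p c 1) * orient (p a) (p b) (p c) = 0
      simp only [orient] at *
      linear_combination (p d 1 - p c 1) * e1 - (p b 1 - p a 1) * e2 - (q 1 - p c 1) * hk
  refine hcd (Plane.ext ?_ ?_)
  · linarith [(mul_eq_zero.1 (key 0)).resolve_right hn]
  · linarith [(mul_eq_zero.1 (key 1)).resolve_right hn]

theorem injective (hp : GeneralPosition p) (h3 : ∀ u v : V, ∃ w, w ≠ u ∧ w ≠ v) :
    Function.Injective p := by
  intro u v huv
  by_contra hne
  obtain ⟨w, hu, hv⟩ := h3 u v
  exact hp.orient_ne_zero u v w hne (Ne.symm hv) (Ne.symm hu) (by simp [orient, huv])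

end GeneralPosition

theorem isSimpleCurve_segment {p q : Plane} (h : p ≠ q) : IsSimpleCurve p q (segment ℝ p q) := by
  refine ⟨fun t => AffineMap.lineMap p q (t : ℝ), ?_, ?_, by simp, by simp, ?_⟩
  · exact AffineMap.lineMap_continuous.comp continuous_subtype_val
  · exact (AffineMap.lineMap_injective ℝ h).comp Subtype.val_injective
  · rw [segment_eq_image_lineMap]
    ext x
    simp

/-- The straight-line drawing on points in general position. -/
def straightLineDrawing {V : Type} (p : V → Plane) (hp : GeneralPosition p)
    (h3 : ∀ u v : V, ∃ w, w ≠ u ∧ w ≠ v) : TopologicalDrawing V where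
  vertex := p
  edge := segmentEdge p
  vertex_injective := hp.injective h3
  edge_isSimpleCurve _ _ huv := isSimpleCurve_segment ((hp.injective h3).ne huv)
  mem_of_vertex_mem_edge _ he _ hw := hp.mem_of_mem_segmentEdge he hw
  edge_inter_subsingleton _ _ he hf hef := hp.inter_subsingleton he hf hef
  common_vertex_or_crossing e f he hf hef q hq := by
    by_cases h : ∃ v, v ∈ e ∧ v ∈ f
    · obtain ⟨v, hve, hvf⟩ := h
      exact Or.inl ⟨v, hve, hvf, hp.eq_vertex_of_mem he hf hef hq hve hvf⟩
    · push Not at h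
      exact Or.inr (hp.isCrossing he hf h hq)
  no_triple_crossing e f g he hf hg hef heg hfg q hqe hqf hqg := by
    by_contra hq
    -- Two edges sharing a vertex meet only there, so if `q` is not a vertex the three edges are
    -- pairwise disjoint as pairs.
    refine hp.not_concurrent e f g he hf hg ?_ ?_ ?_ q
      ⟨orient_eq_zero_of_mem_segmentEdge hqe, orient_eq_zero_of_mem_segmentEdge hqf,
        orient_eq_zero_of_mem_segmentEdge hqg⟩
    · exact fun v h1 h2 => hq ⟨v, hp.eq_vertex_of_mem he hf hef ⟨hqe, hqf⟩ h1 h2⟩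
    · exact fun v h1 h2 => hq ⟨v, hp.eq_vertex_of_mem he hg heg ⟨hqe, hqg⟩ h1 h2⟩
    · exact fun v h1 h2 => hq ⟨v, hp.eq_vertex_of_mem hf hg hfg ⟨hqf, hqg⟩ h1 h2⟩

theorem straightLineDrawing_isStraightLine {V : Type} (p : V → Plane) (hp : GeneralPosition p)
    (h3 : ∀ u v : V, ∃ w, w ≠ u ∧ w ≠ v) : (straightLineDrawing p hp h3).IsStraightLine :=
  fun _ _ _ => rfl

/-! ### Inverted drawings -/

namespace TopologicalDrawing

variable {V : Type}

theorem zero_notMem_edge (D : TopologicalDrawing V) (h0 : (0 : Plane) ∉ D.carrier) {e : Sym2 V}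
    (he : ¬ e.IsDiag) : (0 : Plane) ∉ D.edge e := fun h => h0 (Or.inr ⟨e, he, h⟩)

/-- The image of a drawing missing the origin under inversion. -/
noncomputable def invert (D : TopologicalDrawing V) (h0 : (0 : Plane) ∉ D.carrier) :
    TopologicalDrawing V where
  vertex v := circleInv (D.vertex v)
  edge e := circleInv ⁻¹' D.edge e
  vertex_injective := circleInv_injective.comp D.vertex_injective
  edge_isSimpleCurve u v huv := (D.edge_isSimpleCurve u v huv).circleInv
    (D.zero_notMem_edge h0 (by rwa [Sym2.mk_isDiag_iff]))
  mem_of_vertex_mem_edge e he w hw := D.mem_of_vertex_mem_edge e he w (by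
    rwa [mem_preimage, circleInv_circleInv] at hw)
  edge_inter_subsingleton e f he hf hef :=
    (D.edge_inter_subsingleton e f he hf hef).preimage circleInv_injective
  common_vertex_or_crossing e f he hf hef q hq := by
    rcases D.common_vertex_or_crossing e f he hf hef (circleInv q) hq with ⟨v, h1, h2, h3⟩ | h
    · exact Or.inl ⟨v, h1, h2, by rw [h3, circleInv_circleInv]⟩
    · right
      have := h.circleInv fun h => D.zero_notMem_edge h0 he (h ▸ hq.1)
      rwa [circleInv_circleInv] at this
  no_triple_crossing e f g he hf hg hef heg hfg q h1 h2 h3 := by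
    obtain ⟨v, hv⟩ := D.no_triple_crossing e f g he hf hg hef heg hfg _ h1 h2 h3
    exact ⟨v, (congrArg circleInv hv).trans (circleInv_circleInv q)⟩

theorem sameOnSphere_invert (D : TopologicalDrawing V) (h0 : (0 : Plane) ∉ D.carrier) :
    D.SameOnSphere (D.invert h0) := by
  have hv : ∀ v, D.vertex v ≠ 0 := fun v h => h0 (Or.inl ⟨v, h⟩)
  refine ⟨sphereInvHomeomorph, fun v => sphereInv_coe (hv v), fun u v huv => ?_⟩
  have he : (0 : Plane) ∉ D.edge s(u, v) := D.zero_notMem_edge h0 (by rwa [Sym2.mk_isDiag_iff])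
  rw [image_image]
  change _ = _ '' (circleInv ⁻¹' D.edge s(u, v))
  rw [← image_circleInv, image_image]
  exact image_congr fun q hq => sphereInv_coe fun h => he (h ▸ hq)

theorem mem_carrier_invert (D : TopologicalDrawing V) (h0 : (0 : Plane) ∉ D.carrier) {q : Plane} :
    q ∈ (D.invert h0).carrier ↔ circleInv q ∈ D.carrier := by
  refine or_congr (exists_congr fun v => ?_) Iff.rfl
  change circleInv (D.vertex v) = q ↔ D.vertex v = circleInv q
  constructor
  · rintro rfl
    rw [circleInv_circleInv]
  · intro h
    rw [h, circleInv_circleInv]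

end TopologicalDrawing

/-! ### Face-convexity and containment in inverted straight-line drawings. -/

section InvertedStraightLine

variable {V : Type} {p : V → Plane} {hp : GeneralPosition p} {h3 : ∀ u v : V, ∃ w, w ≠ u ∧ w ≠ v}

theorem notMem_carrier_straightLineDrawing {q : Plane}
    (hq : ∀ a b, a ≠ b → orient (p a) (p b) q ≠ 0) : q ∉ (straightLineDrawing p hp h3).carrier := by
  rintro (⟨v, rfl⟩ | ⟨e, he, h⟩)
  · obtain ⟨w, hw, -⟩ := h3 v v
    exact hq v w hw.symm (orient_self_left _ _)
  · induction e with | _ a b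
    rw [Sym2.mk_isDiag_iff] at he
    exact hq a b he (orient_eq_zero_of_mem_segment h)

variable {h0 : (0 : Plane) ∉ (straightLineDrawing p hp h3).carrier} {a b c : V}

theorem triangle_straightLineDrawing (hab : a ≠ b) (hbc : b ≠ c) (hac : a ≠ c) :
    (straightLineDrawing p hp h3).triangle a b c =
      closedTriangle (p a) (p b) (p c) \ openTriangle (p a) (p b) (p c) :=
  union_segments_eq (hp.orient_ne_zero a b c hab hbc hac)

theorem triangle_invert (hab : a ≠ b) (hbc : b ≠ c) (hac : a ≠ c) :
    ((straightLineDrawing p hp h3).invert h0).triangle a b c =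
      circleInv ⁻¹' (closedTriangle (p a) (p b) (p c) \ openTriangle (p a) (p b) (p c)) := by
  rw [← triangle_straightLineDrawing (hp := hp) (h3 := h3) hab hbc hac]
  rfl

theorem TopologicalDrawing.triangle_subset_carrier (D : TopologicalDrawing V) (hab : a ≠ b)
    (hbc : b ≠ c) (hac : a ≠ c) : D.triangle a b c ⊆ D.carrier := by
  rintro q ((h | h) | h)
  · exact Or.inr ⟨_, by rwa [Sym2.mk_isDiag_iff], h⟩
  · exact Or.inr ⟨_, by rwa [Sym2.mk_isDiag_iff], h⟩
  · exact Or.inr ⟨_, by rwa [Sym2.mk_isDiag_iff], h⟩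

theorem zero_notMem_triangle (h0 : (0 : Plane) ∉ (straightLineDrawing p hp h3).carrier)
    (hab : a ≠ b) (hbc : b ≠ c) (hac : a ≠ c) :
    (0 : Plane) ∉ closedTriangle (p a) (p b) (p c) \ openTriangle (p a) (p b) (p c) := by
  rw [← triangle_straightLineDrawing (hp := hp) (h3 := h3) hab hbc hac]
  exact fun h => h0 (TopologicalDrawing.triangle_subset_carrier _ hab hbc hac h)

/-- Inverting a straight-line drawing yields a face-convex drawing; the special face is the image
of the unbounded face. -/
theorem isFaceConvex_invert : ((straightLineDrawing p hp h3).invert h0).IsFaceConvex := by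
  set D := (straightLineDrawing p hp h3).invert h0 with hD
  have h0D : (0 : Plane) ∈ D.carrierᶜ := fun h => h0 (by
    rwa [TopologicalDrawing.mem_carrier_invert, circleInv_zero] at h)
  -- The special face is the component of `0`, the image of infinity.
  refine ⟨_, ⟨0, h0D, rfl⟩, ?_⟩
  rintro a b c hab hbc hac _ ⟨q, hq, rfl⟩ hF
  have ht := hp.orient_ne_zero a b c hab hbc hac
  have hz := zero_notMem_triangle h0 hab hbc hac
  have hsub : D.carrierᶜ ⊆ (D.triangle a b c)ᶜ :=
    compl_subset_compl.2 (D.triangle_subset_carrier hab hbc hac)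
  have htri := triangle_invert (h0 := h0) hab hbc hac
  rw [← hD] at htri
  rw [htri] at hq hF hsub ⊢
  rw [compl_inv_triangle hz] at hq
  rcases hq with hq | hq
  · rw [component_eq_inv_openTriangle ht hz hq]
    have hv : ∀ v, D.vertex v ∈ closure (invRegion (openTriangle (p a) (p b) (p c))) →
        p v ∈ closedTriangle (p a) (p b) (p c) := by
      intro v hv
      have hv0 : p v ≠ 0 := fun h => h0 (Or.inl ⟨v, h⟩)
      change circleInv (p v) ∈ _ at hv
      rw [closure_invRegion (fun h => hv0 (circleInv_eq_zero.1 h)), circleInv_circleInv] at hv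
      exact closure_minimal (openTriangle_subset_closedTriangle (p a) (p b) (p c))
        (isClosed_closedTriangle _ _ _) hv
    intro u v huv hu hv' r hr
    have hr' : circleInv r ∈ segment ℝ (p u) (p v) := hr
    have hr0 : r ≠ 0 := by
      rintro rfl
      exact h0D (Or.inr ⟨s(u, v), by rwa [Sym2.mk_isDiag_iff], hr⟩)
    rw [closure_invRegion hr0]
    exact closedTriangle_subset_closure ht
      ((convex_closedTriangle _ _ _).segment_subset (hv u hu) (hv v hv') hr')
  -- The exterior side is the component of `0` in the larger complement of the triangle alone, so it
  -- contains the special face.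
  · refine absurd (Subset.trans ?_ subset_closure) hF
    rw [component_eq_invExterior ht hz hq]
    rw [← component_eq_invExterior ht hz (p := 0) (Or.inl rfl)]
    exact connectedComponentIn_mono 0 hsub

/-- The old region containing `0` becomes the unbounded side. The hypothesis says that the old
triangle separates `0` from `x`, so `x` lands in the bounded side. -/
theorem triangleContains_invert {x : Plane} (hab : a ≠ b) (hbc : b ≠ c) (hac : a ≠ c)
    (hx : x ≠ 0)
    (h : ((0 : Plane) ∈ openTriangle (p a) (p b) (p c) ∧ x ∉ closedTriangle (p a) (p b) (p c)) ∨
      ((0 : Plane) ∉ closedTriangle (p a) (p b) (p c) ∧ x ∈ openTriangle (p a) (p b) (p c))) :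
    ((straightLineDrawing p hp h3).invert h0).TriangleContains a b c (circleInv x) := by
  have ht := hp.orient_ne_zero a b c hab hbc hac
  have hz := zero_notMem_triangle h0 hab hbc hac
  have hx' : circleInv x ≠ 0 := fun h => hx (circleInv_eq_zero.1 h)
  rw [TopologicalDrawing.TriangleContains]
  simp only [TopologicalDrawing.IsSide]
  rw [triangle_invert hab hbc hac]
  rcases h with ⟨hO, hX⟩ | ⟨hO, hX⟩
  · have hmem : circleInv x ∈ invExterior (p a) (p b) (p c) :=
      Or.inr ⟨hx', by rwa [circleInv_circleInv]⟩
    refine ⟨_, ⟨circleInv x, ?_, rfl⟩, ?_, ?_⟩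
    · rw [compl_inv_triangle hz]
      exact Or.inr hmem
    · rw [component_eq_invExterior ht hz hmem, Metric.isBounded_closure_iff]
      refine Bornology.isBounded_singleton.union (isBounded_invRegion ?_)
      rw [compl_compl]
      exact mem_of_superset ((isOpen_openTriangle _ _ _).mem_nhds hO)
        (openTriangle_subset_closedTriangle _ _ _)
    · rw [component_eq_invExterior ht hz hmem]
      exact subset_closure hmem
  · have hmem : circleInv x ∈ invRegion (openTriangle (p a) (p b) (p c)) :=
      ⟨hx', by rwa [circleInv_circleInv]⟩
    refine ⟨_, ⟨circleInv x, ?_, rfl⟩, ?_, ?_⟩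
    · rw [compl_inv_triangle hz]
      exact Or.inl hmem
    · rw [component_eq_inv_openTriangle ht hz hmem, Metric.isBounded_closure_iff]
      refine isBounded_invRegion (mem_of_superset
        ((isClosed_closedTriangle _ _ _).isOpen_compl.mem_nhds hO) ?_)
      exact compl_subset_compl.2 (openTriangle_subset_closedTriangle _ _ _)
    · rw [component_eq_inv_openTriangle ht hz hmem]
      exact subset_closure hmem

/-- Since `circleInv` is not continuous at `0`, closedness of the curve there comes from boundedness
of the triangle. -/
theorem isOpen_compl_inv_triangle {u v w : Plane} (ht : orient u v w ≠ 0)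
    (hz : (0 : Plane) ∉ closedTriangle u v w \ openTriangle u v w) :
    IsOpen (circleInv ⁻¹' (closedTriangle u v w \ openTriangle u v w))ᶜ := by
  refine isOpen_compl_iff.2 ?_
  have hcl : IsClosed (closedTriangle u v w \ openTriangle u v w) :=
    (isClosed_closedTriangle u v w).sdiff (isOpen_openTriangle u v w)
  have heq : circleInv ⁻¹' (closedTriangle u v w \ openTriangle u v w) =
      invRegion (closedTriangle u v w \ openTriangle u v w) := by
    rw [← image_circleInv, ← image_diff_zero, sdiff_singleton_eq_self hz]
  rw [heq]
  refine isClosed_of_closure_subset fun q hq => ?_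
  have hq0 : q ≠ 0 := by
    rintro rfl
    exact zero_notMem_closure_invRegion ((isBounded_closedTriangle ht).subset sdiff_subset) hq
  rw [closure_invRegion hq0, hcl.closure_eq] at hq
  exact ⟨hq0, hq⟩

theorem not_triangleContains_invert {x : Plane} (hab : a ≠ b) (hbc : b ≠ c) (hac : a ≠ c)
    (hx : x ≠ 0)
    (h : ((0 : Plane) ∈ openTriangle (p a) (p b) (p c) ∧ x ∈ openTriangle (p a) (p b) (p c)) ∨
      ((0 : Plane) ∉ closedTriangle (p a) (p b) (p c) ∧
        x ∉ closedTriangle (p a) (p b) (p c))) :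
    ¬ ((straightLineDrawing p hp h3).invert h0).TriangleContains a b c (circleInv x) := by
  have ht := hp.orient_ne_zero a b c hab hbc hac
  have hz := zero_notMem_triangle h0 hab hbc hac
  have hx' : circleInv x ≠ 0 := fun h => hx (circleInv_eq_zero.1 h)
  rintro ⟨_, ⟨q, -, rfl⟩, hb, hxS⟩
  rw [triangle_invert hab hbc hac] at hb hxS
  have hopen := isOpen_compl_inv_triangle ht hz
  rw [Metric.isBounded_closure_iff] at hb
  have hx0 : circleInv x ∈
      (circleInv ⁻¹' (closedTriangle (p a) (p b) (p c) \ openTriangle (p a) (p b) (p c)))ᶜ := by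
    rw [mem_compl_iff, mem_preimage, circleInv_circleInv]
    rintro ⟨h1, h2⟩
    exact h.elim (fun h => h2 h.2) fun h => h.2 h1
  -- The component of `circleInv x` is open and `circleInv x` is in the closure of the component of
  -- `q`, so the two components meet and coincide. That component is unbounded, since its preimage
  -- surrounds `0`.
  obtain ⟨r, hr1, hr2⟩ := mem_closure_iff.1 hxS _ (hopen.connectedComponentIn (x := circleInv x))
    (mem_connectedComponentIn hx0)
  rw [connectedComponentIn_eq hr2, ← connectedComponentIn_eq hr1] at hb
  rcases h with ⟨hO, hX⟩ | ⟨hO, hX⟩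
  · rw [component_eq_inv_openTriangle ht hz ⟨hx', by rwa [circleInv_circleInv]⟩] at hb
    exact not_isBounded_invRegion ((isOpen_openTriangle _ _ _).mem_nhds hO) hb
  · rw [component_eq_invExterior ht hz (Or.inr ⟨hx', by rwa [circleInv_circleInv]⟩)] at hb
    exact not_isBounded_invRegion ((isClosed_closedTriangle _ _ _).isOpen_compl.mem_nhds hO)
      (hb.subset subset_union_right)

end InvertedStraightLine

/-! ### The configuration -/

/-- The point of the plane with the given integer coordinates. -/
noncomputable def latticePoint (z : ℤ × ℤ) : Plane := !₂[(z.1 : ℝ), (z.2 : ℝ)]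

/-- Twice the signed area of a lattice triangle. -/
def latticeOrient (a b c : ℤ × ℤ) : ℤ := (b.1 - a.1) * (c.2 - a.2) - (b.2 - a.2) * (c.1 - a.1)

theorem orient_latticePoint (a b c : ℤ × ℤ) :
    orient (latticePoint a) (latticePoint b) (latticePoint c) = latticeOrient a b c := by
  simp [orient, latticePoint, latticeOrient]

/-- The determinant of the lines `ab`, `cd`, `ef`, which vanishes if they are concurrent. -/
def latticeConcurrency (a b c d e f : ℤ × ℤ) : ℤ :=
  (a.2 - b.2) * ((d.1 - c.1) * (e.1 * f.2 - e.2 * f.1) - (c.1 * d.2 - c.2 * d.1) * (f.1 - e.1))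
    - (b.1 - a.1) * ((c.2 - d.2) * (e.1 * f.2 - e.2 * f.1) - (c.1 * d.2 - c.2 * d.1) * (e.2 - f.2))
    + (a.1 * b.2 - a.2 * b.1) * ((c.2 - d.2) * (f.1 - e.1) - (d.1 - c.1) * (e.2 - f.2))

theorem latticeConcurrency_eq_zero {a b c d e f : ℤ × ℤ} {q : Plane}
    (h1 : orient (latticePoint a) (latticePoint b) q = 0)
    (h2 : orient (latticePoint c) (latticePoint d) q = 0)
    (h3 : orient (latticePoint e) (latticePoint f) q = 0) :
    latticeConcurrency a b c d e f = 0 := by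
  have h := det_eq_zero_of_concurrent h1 h2 h3
  rw [Matrix.det_fin_three] at h
  simp [latticePoint] at h
  rw [← Int.cast_inj (α := ℝ), latticeConcurrency]
  push_cast
  linear_combination h

/-- Nine points, in three color classes of consecutive points. -/
def ninePoints : Fin 9 → ℤ × ℤ :=
  ![(3, 7), (-4, -6), (-1, 5), (-6, 6), (7, 4), (6, -8), (-6, 2), (5, 3), (4, -3)]

/-- A lattice point lies strictly inside a lattice triangle. -/
abbrev LatticeInside (a b c q : ℤ × ℤ) : Prop :=
  0 < latticeOrient b c q * latticeOrient a b c ∧ 0 < latticeOrient c a q * latticeOrient a b c ∧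
    0 < latticeOrient a b q * latticeOrient a b c

/-- A lattice point lies strictly outside a lattice triangle. -/
abbrev LatticeOutside (a b c q : ℤ × ℤ) : Prop :=
  latticeOrient b c q * latticeOrient a b c < 0 ∨ latticeOrient c a q * latticeOrient a b c < 0 ∨
    latticeOrient a b q * latticeOrient a b c < 0

theorem LatticeInside.mem {a b c q : ℤ × ℤ} (h : LatticeInside a b c q) :
    latticePoint q ∈ openTriangle (latticePoint a) (latticePoint b) (latticePoint c) := by
  simp only [openTriangle, mem_ofPred_eq, orient_latticePoint]
  exact_mod_cast h

theorem LatticeOutside.notMem {a b c q : ℤ × ℤ} (h : LatticeOutside a b c q) :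
    latticePoint q ∉ closedTriangle (latticePoint a) (latticePoint b) (latticePoint c) := by
  simp only [closedTriangle, mem_ofPred_eq, orient_latticePoint, not_and_or, not_le]
  exact_mod_cast h

theorem latticePoint_zero : latticePoint (0, 0) = 0 := by
  apply Plane.ext <;> simp [latticePoint]

theorem ninePoints_orient : ∀ a b c : Fin 9, a ≠ b → b ≠ c → a ≠ c →
    latticeOrient (ninePoints a) (ninePoints b) (ninePoints c) ≠ 0 := by
  decide +kernel

/-- Swapping the points of a pair only changes the sign of the determinant, so each pair is taken in
increasing order. Every restriction precedes the next quantifier, to prune the enumeration. -/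
theorem ninePoints_concurrency : ∀ a b : Fin 9, a < b → ∀ c, c ≠ a → c ≠ b → ∀ d, c < d →
    d ≠ a → d ≠ b → ∀ e, e ≠ a → e ≠ b → e ≠ c → e ≠ d → ∀ f, e < f →
    f ≠ a → f ≠ b → f ≠ c → f ≠ d → latticeConcurrency (ninePoints a) (ninePoints b)
      (ninePoints c) (ninePoints d) (ninePoints e) (ninePoints f) ≠ 0 := by
  decide +kernel

theorem Sym2.exists_lt_of_not_isDiag {α : Type*} [LinearOrder α] {e : Sym2 α} (h : ¬ e.IsDiag) :
    ∃ a b, a < b ∧ e = s(a, b) := by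
  induction e with | _ a b
  rw [Sym2.mk_isDiag_iff] at h
  rcases lt_or_gt_of_ne h with h | h
  · exact ⟨a, b, h, rfl⟩
  · exact ⟨b, a, h, Sym2.eq_swap⟩

theorem generalPosition_ninePoints :
    GeneralPosition fun v => latticePoint (ninePoints v) where
  orient_ne_zero a b c hab hbc hac := by
    rw [orient_latticePoint]
    exact_mod_cast ninePoints_orient a b c hab hbc hac
  not_concurrent e f g he hf hg hef heg hfg q h := by
    obtain ⟨a, b, hab, rfl⟩ := Sym2.exists_lt_of_not_isDiag he
    obtain ⟨c, d, hcd, rfl⟩ := Sym2.exists_lt_of_not_isDiag hf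
    obtain ⟨i, j, hij, rfl⟩ := Sym2.exists_lt_of_not_isDiag hg
    simp only [Sym2.mem_iff, forall_eq_or_imp, forall_eq, not_or] at hef heg hfg
    refine ninePoints_concurrency a b hab c (Ne.symm hef.1.1) (Ne.symm hef.2.1) d hcd
      (Ne.symm hef.1.2) (Ne.symm hef.2.2) i (Ne.symm heg.1.1) (Ne.symm heg.2.1)
      (Ne.symm hfg.1.1) (Ne.symm hfg.2.1) j hij (Ne.symm heg.1.2) (Ne.symm heg.2.2)
      (Ne.symm hfg.1.2) (Ne.symm hfg.2.2) ?_
    exact latticeConcurrency_eq_zero (h.1 a b rfl) (h.2.1 c d rfl) (h.2.2 i j rfl)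

theorem exists_third_vertex : ∀ u v : Fin 9, ∃ w, w ≠ u ∧ w ≠ v := by decide

theorem ninePoints_orient_zero : ∀ a b : Fin 9, a ≠ b →
    latticeOrient (ninePoints a) (ninePoints b) (0, 0) ≠ 0 := by
  decide +kernel

theorem ninePoints_orient_target : ∀ a b : Fin 9, a ≠ b →
    latticeOrient (ninePoints a) (ninePoints b) (-2, -1) ≠ 0 := by
  decide +kernel

/-- The color classes are the three triples of consecutive points. -/
def nineColors : Fin 9 → Fin 3 := ![0, 0, 0, 1, 1, 1, 2, 2, 2]

/-- Separation of `(0, 0)` from `(-2, -1)`, which inversion turns into containment of the image of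
`(-2, -1)`. -/
theorem ninePoints_monochromatic : ∀ a b c : Fin 9, a ≠ b → b ≠ c → a ≠ c →
    nineColors a = nineColors b → nineColors b = nineColors c →
    (LatticeInside (ninePoints a) (ninePoints b) (ninePoints c) (0, 0) ∧
      LatticeOutside (ninePoints a) (ninePoints b) (ninePoints c) (-2, -1)) ∨
    (LatticeOutside (ninePoints a) (ninePoints b) (ninePoints c) (0, 0) ∧
      LatticeInside (ninePoints a) (ninePoints b) (ninePoints c) (-2, -1)) := by
  decide +kernel

/-- Non-separation of the same two points, which rules out containment after inversion. -/
theorem ninePoints_rainbow : ∀ a b c : Fin 9, nineColors a ≠ nineColors b →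
    nineColors b ≠ nineColors c → nineColors a ≠ nineColors c →
    (LatticeInside (ninePoints a) (ninePoints b) (ninePoints c) (0, 0) ∧
      LatticeInside (ninePoints a) (ninePoints b) (ninePoints c) (-2, -1)) ∨
    (LatticeOutside (ninePoints a) (ninePoints b) (ninePoints c) (0, 0) ∧
      LatticeOutside (ninePoints a) (ninePoints b) (ninePoints c) (-2, -1)) := by
  decide +kernel

theorem mainTheorem6 :
    ∃ D : TopologicalDrawing (Fin 9),
      D.IsFaceConvex ∧
      (∃ L : TopologicalDrawing (Fin 9), L.IsStraightLine ∧ L.SameOnSphere D) ∧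
      ∃ (color : Fin 9 → Fin 3) (x : Plane),
        (∀ i : Fin 3, (Finset.univ.filter (fun v => color v = i)).card = 3) ∧
        x ∉ D.carrier ∧
        (∀ a b c : Fin 9, a ≠ b → b ≠ c → a ≠ c → color a = color b → color b = color c →
          D.TriangleContains a b c x) ∧
        (∀ a b c : Fin 9, color a ≠ color b → color b ≠ color c → color a ≠ color c →
          ¬ D.TriangleContains a b c x) := by
  have hp := generalPosition_ninePoints
  have h0 : (0 : Plane) ∉ (straightLineDrawing _ hp exists_third_vertex).carrier := by
    refine notMem_carrier_straightLineDrawing fun a b hab => ?_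
    rw [← latticePoint_zero, orient_latticePoint]
    exact_mod_cast ninePoints_orient_zero a b hab
  have hx : latticePoint (-2, -1) ∉ (straightLineDrawing _ hp exists_third_vertex).carrier := by
    refine notMem_carrier_straightLineDrawing fun a b hab => ?_
    rw [orient_latticePoint]
    exact_mod_cast ninePoints_orient_target a b hab
  have hx0 : latticePoint (-2, -1) ≠ 0 := fun h => by
    simpa [latticePoint] using congrArg (fun p : Plane => p 0) h
  refine ⟨(straightLineDrawing _ hp exists_third_vertex).invert h0, isFaceConvex_invert,
    ⟨_, straightLineDrawing_isStraightLine _ hp exists_third_vertex,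
      TopologicalDrawing.sameOnSphere_invert _ h0⟩,
    nineColors, circleInv (latticePoint (-2, -1)), by decide, ?_, ?_, ?_⟩
  · rwa [TopologicalDrawing.mem_carrier_invert, circleInv_circleInv]
  · intro a b c hab hbc hac h1 h2
    refine triangleContains_invert hab hbc hac hx0 ?_
    rw [← latticePoint_zero]
    exact (ninePoints_monochromatic a b c hab hbc hac h1 h2).imp
      (fun h => ⟨h.1.mem, h.2.notMem⟩) fun h => ⟨h.1.notMem, h.2.mem⟩
  · intro a b c h1 h2 h3
    refine not_triangleContains_invert (fun h => h1 (h ▸ rfl)) (fun h => h2 (h ▸ rfl))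
      (fun h => h3 (h ▸ rfl)) hx0 ?_
    rw [← latticePoint_zero]
    exact (ninePoints_rainbow a b c h1 h2 h3).imp
      (fun h => ⟨h.1.mem, h.2.mem⟩) fun h => ⟨h.1.notMem, h.2.notMem⟩
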